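/- Let $\mathbf{k}$ be a field of characteristic zero, let $m\ge 2$, $n\ge 1$ and $k\ge 0$ be integers, and let $R=\mathbf{k}[x_1,\dots,x_{2n}]$ with the standard grading. Let $I_{2n,m,1}=(x_1^{m},\dots,x_{2n}^{m},\,x_1+\cdots+x_{2n})\subset R$, and let $\operatorname{in}(I_{2n,m,1})$ be its initial ideal with respect to a monomial ordering with $x_1\succ\cdots\succ x_{2n}$ (for instance the degree reverse lexicographic ordering), i.e. the ideal generated by the largest monomials of the nonzero elements of $I_{2n,m,1}$. For $s\ge 1$ let $\binom{N}{d}_s$ be the coefficient of $x^d$ in $(1+x+\cdots+x^s)^N$, and let $$C^{(s)}_{n,k}=\binom{2n}{sn+k}_s-\binom{2n}{sn+k+1}_s$$ be the entry in row $n$ and column $k$ of the $s$-Catalan triangle. An $m$-admissible lattice path (with $2n$ steps) starts at the origin, and each of its $2n$ steps is of the form $(a,b)\to(a+1,b+1-e)$ with an integer $0\le e\le m-1$. It corresponds to the monomial $x_1^{e_1}\cdots x_{2n}^{e_{2n}}$, where $e_i$ is the number $e$ of its $i$-th step; the monomials obtained are exactly the $m$-free ones (all exponents less than $m$). The degree of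 a path is the degree $e_1+\cdots+e_{2n}$ of its monomial. Then $C^{(m-1)}_{n,k}$ is equal to the number of $m$-admissible lattice paths of degree $n(m-1)-k$ whose corresponding $m$-free monomials do not lie in $\operatorname{in}(I_{2n,m,1})$. Moreover, it is a value of the Hilbert function of $R/I_{2n,m,1}$: $$C^{(m-1)}_{n,k}=\dim_{\mathbf{k}}\,(R/I_{2n,m,1})_{n(m-1)-k}.$$ (If $k>n(m-1)$, the degree is negative, and all these numbers are zero.) -/

import Mathlib

namespace CatalanPaths

open MvPolynomial

/-- A lattice path with `N` steps, given by its vertices `P 0, …, P N` in `ℤ²`, is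
`m`-admissible if it starts at the origin and its `i`-th step is a 1-up step, a flat step, or
an `(e-1)`-down step for some `2 ≤ e ≤ m i - 1`. -/
def IsAdmissiblePath {N : ℕ} (m : Fin N → ℕ) (P : Fin (N + 1) → ℤ × ℤ) : Prop :=
  P 0 = (0, 0) ∧
  ∀ i : Fin N,
    P i.succ = P i.castSucc + (1, 1) ∨
    P i.succ = P i.castSucc + (1, 0) ∨
    ∃ e : ℕ, 2 ≤ e ∧ e + 1 ≤ m i ∧ P i.succ = P i.castSucc + (1, 1 - (e : ℤ))

/-- The exponent vector of the monomial corresponding to a path: the exponent of the `i`-th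
variable is `0` if the `i`-th step is 1-up, `1` if it is flat, and `e` if it is `(e-1)`-down.
In all cases the height changes by `1 - e` on the `i`-th step, where `e` is the exponent. -/
noncomputable def pathMonomial {N : ℕ} (P : Fin (N + 1) → ℤ × ℤ) : Fin N →₀ ℕ :=
  Finsupp.equivFunOnFinite.symm fun i => (1 - ((P i.succ).2 - (P i.castSucc).2)).toNat

/-- The ideal `I_{N,m,k} = (x_1^{m_1}, …, x_N^{m_N}, (x_1 + ⋯ + x_N)^k)`. -/
noncomputable def powerIdeal (K : Type*) [Field K] (N : ℕ) (m : Fin N → ℕ) (k : ℕ) :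
    Ideal (MvPolynomial (Fin N) K) :=
  Ideal.span (Set.range (fun i : Fin N => (X i : MvPolynomial (Fin N) K) ^ m i) ∪
    {(∑ i : Fin N, (X i : MvPolynomial (Fin N) K)) ^ k})

/-- The initial ideal of `I`, generated by the initial monomials of the nonzero elements of `I`
(`ord.degree f` is the exponent vector of the largest monomial in the support of `f`). -/
noncomputable def initialIdeal {K σ : Type*} [Field K] (ord : MonomialOrder σ)
    (I : Ideal (MvPolynomial σ K)) : Ideal (MvPolynomial σ K) :=
  Ideal.span {p | ∃ f ∈ I, f ≠ 0 ∧ p = monomial (ord.degree f) 1}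

/-- The Hilbert function `d ↦ dim_K (R/I)_d` of the quotient of a polynomial ring `R` by a
homogeneous ideal `I`: the degree `d` component of `R/I` is the image of that of `R`.
Degrees are integers, and the components of negative degree are zero. -/
noncomputable def hilbertFunction {K σ : Type*} [Field K] (I : Ideal (MvPolynomial σ K))
    (d : ℤ) : ℕ :=
  Module.finrank K
    ((weightedHomogeneousSubmodule K (fun _ : σ => (1 : ℤ)) d).map
      (Ideal.Quotient.mkₐ K I).toLinearMap)

/-- The `s`-binomial coefficient: the coefficient of `x^d` in `(1 + x + ⋯ + x^s)^n`. -/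
noncomputable def sBinomial (s n d : ℕ) : ℕ :=
  ((∑ i ∈ Finset.range (s + 1), (Polynomial.X : Polynomial ℕ) ^ i) ^ n).coeff d

/-- The entry in row `n` and column `k` of the `s`-Catalan triangle. For `n = 0` the formula
gives the entry `1` in column `0` and the entry `0` in all other columns. -/
noncomputable def sCatalanTriangle (s n k : ℕ) : ℤ :=
  (sBinomial s (2 * n) (s * n + k) : ℤ) - (sBinomial s (2 * n) (s * n + k + 1) : ℤ)

end CatalanPaths

namespace CatalanPaths

open MvPolynomial

/-! ### Standard monomials and Hilbert functions. -/

section StandardMonomials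

variable {σ K : Type*} [Field K]

/-! Let `L = ∑ x_i`, `s = m - 1` and `A = K[x] / (x_i ^ m)`, so that `R / I = A / L A`. By
Macaulay's argument the monomials outside the initial ideal form a basis of `R / I` in each degree
(`hilbertFunction_eq_ncard_standard`), and admissible paths are a recoding of `m`-free exponent
vectors (`bijOn_pathMonomial`), so everything reduces to `dim (A / L A)_d` for `d = n s - k`. An
`𝔰𝔩₂`-type argument shows that `L` is injective on `A` strictly below the middle degree
(`mem_purePowerIdeal_of_sum_X_mul_mem`), whence `dim (A / L A)_d = dim A_d - dim A_{d-1}`. The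
dimensions of `A` are `s`-binomial coefficients, and their symmetry about degree `n s` turns the
difference into the Catalan entry. -/

theorem weight_one_int (e : σ →₀ ℕ) :
    Finsupp.weight (fun _ : σ => (1 : ℤ)) e = (e.degree : ℤ) := by
  simp [Finsupp.weight_apply, Finsupp.degree_apply, Finsupp.sum]

theorem monomial_mem_initialIdeal_iff (ord : MonomialOrder σ) (I : Ideal (MvPolynomial σ K))
    (e : σ →₀ ℕ) :
    monomial e (1 : K) ∈ initialIdeal ord I ↔ ∃ f ∈ I, f ≠ 0 ∧ ord.degree f ≤ e := by
  have h : {p : MvPolynomial σ K | ∃ f ∈ I, f ≠ 0 ∧ p = monomial (ord.degree f) 1} =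
      (fun s => monomial s (1 : K)) '' {s | ∃ f ∈ I, f ≠ 0 ∧ ord.degree f = s} := by
    ext p
    constructor
    · rintro ⟨f, hf, h0, rfl⟩
      exact ⟨_, ⟨f, hf, h0, rfl⟩, rfl⟩
    · rintro ⟨_, ⟨f, hf, h0, rfl⟩, rfl⟩
      exact ⟨f, hf, h0, rfl⟩
  classical
  rw [initialIdeal, h, mem_ideal_span_monomial_image, support_monomial, if_neg one_ne_zero]
  simp only [Finset.mem_singleton, forall_eq, Set.mem_ofPred_eq]
  constructor
  · rintro ⟨_, ⟨f, hf, h0, rfl⟩, hle⟩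
    exact ⟨f, hf, h0, hle⟩
  · rintro ⟨f, hf, h0, hle⟩
    exact ⟨_, ⟨f, hf, h0, rfl⟩, hle⟩

/-- A degree component of the quotient by `I` is determined by a set of monomials of that degree
whose span meets `I` trivially and surjects onto the component. -/
theorem finrank_map_mk_eq_ncard (I : Ideal (MvPolynomial σ K)) (S : Set (σ →₀ ℕ))
    (V : Submodule K (MvPolynomial σ K)) (hSV : restrictSupport K S ≤ V)
    (hinj : ∀ f ∈ restrictSupport K S, f ∈ I → f = 0)
    (hsurj : ∀ f ∈ V, ∃ r ∈ restrictSupport K S, f - r ∈ I) :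
    Module.finrank K (V.map (Ideal.Quotient.mkₐ K I).toLinearMap) = S.ncard := by
  have hmap : V.map (Ideal.Quotient.mkₐ K I).toLinearMap =
      (restrictSupport K S).map (Ideal.Quotient.mkₐ K I).toLinearMap := by
    refine le_antisymm ?_ (Submodule.map_mono hSV)
    rintro _ ⟨f, hf, rfl⟩
    obtain ⟨r, hr, hfr⟩ := hsurj f hf
    exact ⟨r, hr, (Ideal.Quotient.mk_eq_mk_iff_sub_mem _ _).2 (by
      rw [← neg_sub]; exact neg_mem hfr)⟩
  have hdis : Function.Injective
      ((Ideal.Quotient.mkₐ K I).toLinearMap.domRestrict (restrictSupport K S)) := by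
    rw [← LinearMap.ker_eq_bot, LinearMap.ker_eq_bot']
    rintro ⟨f, hf⟩ h
    exact Subtype.ext (hinj f hf (Ideal.Quotient.eq_zero_iff_mem.1 h))
  rw [hmap, ← LinearMap.range_domRestrict, LinearMap.finrank_range_of_inj hdis,
    Module.finrank_eq_nat_card_basis (basisRestrictSupport K S)]
  rfl

theorem restrictSupport_le_weightedHomogeneousSubmodule {S : Set (σ →₀ ℕ)} {d : ℤ}
    (hS : ∀ e ∈ S, (e.degree : ℤ) = d) :
    restrictSupport K S ≤ weightedHomogeneousSubmodule K (fun _ : σ => (1 : ℤ)) d := by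
  intro f hf e he
  rw [weight_one_int]
  exact hS e (hf (mem_support_iff.2 he))

/-- Dividing by all nonzero elements of `I` at once leaves a remainder supported on standard
monomials. The order need not respect degree, so the degree `d` component of the remainder is taken,
which `hI` permits. -/
theorem hilbertFunction_eq_ncard_standard (ord : MonomialOrder σ) (I : Ideal (MvPolynomial σ K))
    (d : ℤ) (hI : ∀ f ∈ I, weightedHomogeneousComponent (fun _ : σ => (1 : ℤ)) d f ∈ I) :
    hilbertFunction I d =
      {e : σ →₀ ℕ | (e.degree : ℤ) = d ∧ monomial e (1 : K) ∉ initialIdeal ord I}.ncard := by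
  refine finrank_map_mk_eq_ncard I _ _
    (restrictSupport_le_weightedHomogeneousSubmodule fun e he => he.1) ?_ ?_
  · intro f hf hfI
    by_contra h0
    exact (hf ((ord.degree_mem_support_iff f).2 h0)).2
      ((monomial_mem_initialIdeal_iff ord I _).2 ⟨f, hfI, h0, le_rfl⟩)
  · intro f hf
    obtain ⟨g, r, hfr, -, hr⟩ := ord.div_set (B := {b | b ∈ I ∧ b ≠ 0})
      (fun b hb => (ord.leadingCoeff_ne_zero_iff.2 hb.2).isUnit) f
    have hq : f - r ∈ I := by
      rw [hfr, add_sub_cancel_right, Finsupp.linearCombination_apply]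
      exact Submodule.sum_mem _ fun b _ => I.mul_mem_left _ b.2.1
    refine ⟨weightedHomogeneousComponent (fun _ : σ => (1 : ℤ)) d r, ?_, ?_⟩
    · intro e he
      classical
      change e ∈ (↑(weightedHomogeneousComponent (fun _ : σ => (1 : ℤ)) d r).support :
        Set (σ →₀ ℕ)) at he
      rw [support_weightedHomogeneousComponent, Finset.coe_filter] at he
      refine ⟨by rw [← weight_one_int]; exact he.2, fun hmem => ?_⟩
      obtain ⟨b, hb, h0, hle⟩ := (monomial_mem_initialIdeal_iff ord I _).1 hmem
      exact hr e he.1 b ⟨hb, h0⟩ hle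
    · have := hI _ hq
      rwa [map_sub, weightedHomogeneousComponent_eq_self hf] at this

end StandardMonomials

/-! ### Injectivity of multiplication by the sum of the variables. -/

section Lefschetz

variable {σ K : Type*} [Field K]

variable (σ K) in
/-- The ideal generated by the `m`-th powers of the variables. -/
noncomputable def purePowerIdeal (m : ℕ) : Ideal (MvPolynomial σ K) :=
  Ideal.span (Set.range fun i : σ => (X i : MvPolynomial σ K) ^ m)

theorem mem_purePowerIdeal_iff {m : ℕ} {f : MvPolynomial σ K} :
    f ∈ purePowerIdeal σ K m ↔ ∀ e ∈ f.support, ∃ i, m ≤ e i := by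
  have h : (Set.range fun i : σ => (X i : MvPolynomial σ K) ^ m) =
      (fun s => monomial s (1 : K)) '' Set.range fun i : σ => Finsupp.single i m := by
    rw [← Set.range_comp]
    congr 1
    funext i
    simp [X_pow_eq_monomial]
  rw [purePowerIdeal, h, mem_ideal_span_monomial_image]
  simp

variable [Fintype σ]

variable (σ K) in
/-- The lowering operator of the `𝔰𝔩₂`-action on `K[x] / (x_i ^ m)` for which multiplication by
the sum of the variables is the raising operator. -/
noncomputable def lowering (m : ℕ) : MvPolynomial σ K →ₗ[K] MvPolynomial σ K :=
  ∑ i : σ, (((m : K) - 1) • (pderiv i).toLinearMap -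
    (LinearMap.mulLeft K (X i)) ∘ₗ (pderiv i).toLinearMap ∘ₗ (pderiv i).toLinearMap)

theorem lowering_apply (m : ℕ) (f : MvPolynomial σ K) :
    lowering σ K m f =
      ∑ i : σ, (((m : K) - 1) • pderiv i f - X i * pderiv i (pderiv i f)) := by
  simp [lowering, LinearMap.sum_apply]

/-- The `i`-th summand sends `x^e` to `e_i (m - e_i) x^e / x_i`, and this coefficient vanishes
exactly where the exponent would drop from `m` to `m - 1`. -/
theorem lowering_mem_purePowerIdeal {m : ℕ} {f : MvPolynomial σ K}
    (hf : f ∈ purePowerIdeal σ K m) : lowering σ K m f ∈ purePowerIdeal σ K m := by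
  classical
  rw [f.as_sum, map_sum]
  refine Submodule.sum_mem _ fun e he => ?_
  obtain ⟨j, hj⟩ := mem_purePowerIdeal_iff.1 hf e he
  rw [lowering_apply]
  refine Submodule.sum_mem _ fun i _ => ?_
  have h : ((m : K) - 1) • pderiv i (monomial e (coeff e f)) -
      X i * pderiv i (pderiv i (monomial e (coeff e f))) =
      monomial (e - Finsupp.single i 1) (coeff e f * (e i * ((m : K) - e i))) := by
    rw [pderiv_monomial, X_mul_pderiv_monomial, smul_monomial, ← map_nsmul, ← map_sub]
    congr 1
    rw [Finsupp.tsub_apply, Finsupp.single_eq_same, nsmul_eq_mul, smul_eq_mul]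
    rcases Nat.eq_zero_or_pos (e i) with h0 | h0
    · simp [h0]
    · push_cast [Nat.cast_sub h0]
      ring
  rw [h, mem_purePowerIdeal_iff]
  intro c hc
  have hc' := mem_support_iff.1 hc
  rw [coeff_monomial] at hc'
  split_ifs at hc' with hec
  · subst hec
    refine ⟨j, ?_⟩
    rw [Finsupp.tsub_apply]
    by_cases hij : i = j
    · subst hij
      have : e i ≠ m := by
        rintro h
        simp [h] at hc'
      simp only [Finsupp.single_eq_same]
      omega
    · simpa [Finsupp.single_apply, hij] using hj
  · exact absurd rfl hc'

/-- The `𝔰𝔩₂` commutator relation: it follows from the Leibniz rule with `∂_i L = 1`, and Euler's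
identity makes it a scalar. -/
theorem lowering_sum_X_mul {m d : ℕ} {f : MvPolynomial σ K} (hf : f.IsHomogeneous d) :
    lowering σ K m ((∑ i, X i) * f) =
      (∑ i, X i) * lowering σ K m f + ((Fintype.card σ : K) * ((m : K) - 1) - 2 * d) • f := by
  classical
  have h (i : σ) : pderiv i (∑ j, X j : MvPolynomial σ K) = 1 := by
    simp [map_sum, pderiv_X, Pi.single_apply]
  have key (i : σ) : ((m : K) - 1) • pderiv i ((∑ j, X j) * f) -
      X i * pderiv i (pderiv i ((∑ j, X j) * f)) =
      (∑ j, X j) * (((m : K) - 1) • pderiv i f - X i * pderiv i (pderiv i f)) +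
        (((m : K) - 1) • f - 2 * (X i * pderiv i f)) := by
    simp only [pderiv_mul, h, one_mul, map_add, smul_add, mul_sub, mul_smul_comm]
    ring
  rw [lowering_apply, lowering_apply, Finset.sum_congr rfl fun i _ => key i,
    Finset.sum_add_distrib, ← Finset.mul_sum,
    Finset.sum_sub_distrib (fun _ => ((m : K) - 1) • f), ← Finset.mul_sum, hf.sum_X_mul_pderiv]
  simp only [Finset.sum_const, Finset.card_univ, smul_eq_C_mul, nsmul_eq_mul, map_sub, map_mul,
    map_natCast, map_one, map_ofNat]
  ring

theorem isHomogeneous_lowering {m d : ℕ} {f : MvPolynomial σ K} (hf : f.IsHomogeneous (d + 1)) :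
    (lowering σ K m f).IsHomogeneous d := by
  rw [lowering_apply]
  refine IsHomogeneous.sum _ _ _ fun i _ => ?_
  have h1 : (pderiv i f).IsHomogeneous d := hf.pderiv
  refine IsHomogeneous.sub ?_ ?_
  · rw [smul_eq_C_mul]
    exact h1.C_mul _
  · obtain _ | d := d
    · rw [totalDegree_eq_zero_iff_eq_C.1 ((totalDegree_zero_iff_isHomogeneous σ).2 h1), pderiv_C,
        mul_zero]
      exact isHomogeneous_zero _ _ _
    · rw [add_comm d 1]
      exact (isHomogeneous_X K i).mul h1.pderiv

/-- The generalization of injectivity that makes induction on `d` close. With `F` the lowering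
operator, applying `F` to `L f + a g` and using `a (f - F g) ≡ 0` gives `L (F f) + (a + c + 1) f ≡
0`, the same hypothesis one degree lower. The scalars stay positive below the middle degree. -/
theorem mem_purePowerIdeal_of_sum_X_mul_add_smul_mem [CharZero K] {m : ℕ} (hm : 1 ≤ m) (d : ℕ)
    (hd : 2 * d < Fintype.card σ * (m - 1)) (a : ℕ) (f g : MvPolynomial σ K)
    (hf : f.IsHomogeneous d)
    (hfg : (a : K) • (f - lowering σ K m g) ∈ purePowerIdeal σ K m)
    (h : (∑ i, X i) * f + (a : K) • g ∈ purePowerIdeal σ K m) :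
    f ∈ purePowerIdeal σ K m := by
  obtain ⟨c, hc⟩ := Nat.exists_eq_add_of_lt hd
  have hcK : (Fintype.card σ : K) * ((m : K) - 1) - 2 * d = ((c + 1 : ℕ) : K) := by
    have : ((m - 1 : ℕ) : K) = (m : K) - 1 := by push_cast [hm]; rfl
    rw [← this, sub_eq_iff_eq_add]
    exact_mod_cast (by omega : Fintype.card σ * (m - 1) = c + 1 + 2 * d)
  have key : (∑ i, X i) * lowering σ K m f + ((a + (c + 1) : ℕ) : K) • f ∈
      purePowerIdeal σ K m := by
    have h1 := lowering_mem_purePowerIdeal h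
    rw [map_add, map_smul, lowering_sum_X_mul hf, hcK] at h1
    convert add_mem h1 hfg using 1
    simp only [smul_eq_C_mul, Nat.cast_add, map_add]
    ring
  have hlow : lowering σ K m f ∈ purePowerIdeal σ K m := by
    cases d with
    | zero =>
      rw [totalDegree_eq_zero_iff_eq_C.1 ((totalDegree_zero_iff_isHomogeneous σ).2 hf)]
      simp [lowering_apply]
    | succ d =>
      -- The pair `(f, g)` becomes `(F f, f)`, whose side condition is `F f - F f = 0`.
      exact mem_purePowerIdeal_of_sum_X_mul_add_smul_mem hm d (by omega) (a + (c + 1))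
        (lowering σ K m f) f (isHomogeneous_lowering hf) (by simp) key
  have h3 := (purePowerIdeal σ K m).mul_mem_left (C ((a + (c + 1) : ℕ) : K)⁻¹)
    (sub_mem key ((purePowerIdeal σ K m).mul_mem_left (∑ i, X i) hlow))
  rwa [add_sub_cancel_left, ← smul_eq_C_mul, smul_smul, inv_mul_cancel₀, one_smul] at h3
  exact Nat.cast_ne_zero.2 (by omega)

theorem mem_purePowerIdeal_of_sum_X_mul_mem [CharZero K] {m : ℕ} (hm : 1 ≤ m) {d : ℕ}
    (hd : 2 * d < Fintype.card σ * (m - 1)) {f : MvPolynomial σ K}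
    (hf : f.IsHomogeneous d) (h : (∑ i, X i) * f ∈ purePowerIdeal σ K m) :
    f ∈ purePowerIdeal σ K m := by
  exact mem_purePowerIdeal_of_sum_X_mul_add_smul_mem hm d hd 0 f 0 hf
    (by simp) (by simpa using h)

end Lefschetz

/-! ### Dimensions of the graded pieces. -/

section Dimension

variable {σ K : Type*} [Field K]

variable (σ) in
/-- The exponent vectors of degree `d` with all entries less than `m`. -/
def freeExponents (m : ℕ) (d : ℤ) : Set (σ →₀ ℕ) :=
  {e | (e.degree : ℤ) = d ∧ ∀ i, e i < m}

theorem weightedHomogeneousComponent_mem_purePowerIdeal {m : ℕ} {f : MvPolynomial σ K}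
    (hf : f ∈ purePowerIdeal σ K m) (d : ℤ) :
    weightedHomogeneousComponent (fun _ : σ => (1 : ℤ)) d f ∈ purePowerIdeal σ K m := by
  classical
  rw [mem_purePowerIdeal_iff] at hf ⊢
  intro e he
  rw [support_weightedHomogeneousComponent] at he
  exact hf e (Finset.mem_filter.1 he).1

theorem finrank_map_mk_purePowerIdeal (m : ℕ) (d : ℤ) :
    Module.finrank K ((weightedHomogeneousSubmodule K (fun _ : σ => (1 : ℤ)) d).map
      (Ideal.Quotient.mkₐ K (purePowerIdeal σ K m)).toLinearMap) =
      (freeExponents σ m d).ncard := by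
  refine finrank_map_mk_eq_ncard _ _ _
    (restrictSupport_le_weightedHomogeneousSubmodule fun e he => he.1) ?_ ?_
  · intro f hf hfJ
    by_contra h0
    obtain ⟨e, he⟩ := support_nonempty.2 h0
    obtain ⟨i, hi⟩ := mem_purePowerIdeal_iff.1 hfJ e he
    exact absurd ((hf he).2 i) (not_lt.2 hi)
  · intro f hf
    classical
    refine ⟨∑ e ∈ f.support with ∀ i, e i < m, monomial e (coeff e f), ?_, ?_⟩
    · refine Submodule.sum_mem _ fun e he => (monomial_mem_restrictSupport K).2 (Or.inl ?_)
      rw [Finset.mem_filter] at he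
      refine ⟨?_, he.2⟩
      rw [← weight_one_int]
      exact hf (mem_support_iff.1 he.1)
    · nth_rw 1 [f.as_sum]
      rw [← Finset.sum_filter_add_sum_filter_not f.support (fun e => ∀ i, e i < m),
        add_sub_cancel_left]
      refine Submodule.sum_mem _ fun e he => mem_purePowerIdeal_iff.2 fun c hc => ?_
      rw [Finset.mem_singleton.1 (support_monomial_subset hc)]
      simpa using (Finset.mem_filter.1 he).2

theorem isHomogeneous_of_isWeightedHomogeneous_natCast {d : ℕ} {f : MvPolynomial σ K}
    (hf : f.IsWeightedHomogeneous (fun _ : σ => (1 : ℤ)) (d : ℤ)) : f.IsHomogeneous d := by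
  intro e he
  have := hf he
  rw [weight_one_int] at this
  rw [← Nat.cast_inj (R := ℤ), ← this, Finsupp.degree_eq_weight_one]
  rfl

variable [Fintype σ]

theorem weightedHomogeneousComponent_sum_X_mul (d : ℤ) (f : MvPolynomial σ K) :
    weightedHomogeneousComponent (fun _ : σ => (1 : ℤ)) d ((∑ i, X i) * f) =
      (∑ i, X i) * weightedHomogeneousComponent (fun _ : σ => (1 : ℤ)) (d - 1) f := by
  classical
  have hL : (∑ i, X i : MvPolynomial σ K).IsWeightedHomogeneous (fun _ : σ => (1 : ℤ)) 1 :=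
    IsWeightedHomogeneous.sum _ _ _ fun i _ => isWeightedHomogeneous_X K _ i
  induction f using MvPolynomial.induction_on' with
  | monomial e a =>
    have he := isWeightedHomogeneous_monomial (fun _ : σ => (1 : ℤ)) e a rfl
    rw [weightedHomogeneousComponent_of_mem he, weightedHomogeneousComponent_of_mem (hL.mul he)]
    by_cases h : d = 1 + Finsupp.weight (fun _ : σ => (1 : ℤ)) e
    · rw [if_pos h, if_pos (by omega)]
    · rw [if_neg h, if_neg (by omega), mul_zero]
  | add p q hp hq => simp only [mul_add, map_add, hp, hq]

theorem mem_purePowerIdeal_of_isWeightedHomogeneous [CharZero K] {m : ℕ} (hm : 1 ≤ m) {d : ℤ}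
    (hd : 2 * d < Fintype.card σ * ((m : ℤ) - 1)) {f : MvPolynomial σ K}
    (hf : f.IsWeightedHomogeneous (fun _ : σ => (1 : ℤ)) d)
    (h : (∑ i, X i) * f ∈ purePowerIdeal σ K m) : f ∈ purePowerIdeal σ K m := by
  rcases lt_or_ge d 0 with h0 | h0
  · have : f = 0 := by
      ext e
      by_contra hc
      have := hf hc
      rw [weight_one_int] at this
      omega
    rw [this]
    exact zero_mem _
  · lift d to ℕ using h0
    refine mem_purePowerIdeal_of_sum_X_mul_mem hm ?_
      (isHomogeneous_of_isWeightedHomogeneous_natCast hf) h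
    zify [hm]
    exact hd

theorem finrank_map_add_finrank_inf_ker {V W : Type*} [AddCommGroup V] [Module K V]
    [AddCommGroup W] [Module K W] (f : V →ₗ[K] W) (U : Submodule K V) [FiniteDimensional K U] :
    Module.finrank K (U.map f) + Module.finrank K (U ⊓ LinearMap.ker f : Submodule K V) =
      Module.finrank K U := by
  rw [← (f.domRestrict U).finrank_range_add_finrank_ker, LinearMap.range_domRestrict,
    LinearMap.ker_domRestrict, ← Submodule.finrank_map_subtype_eq U, Submodule.map_comap_subtype]

theorem finiteDimensional_weightedHomogeneousSubmodule (d : ℤ) :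
    FiniteDimensional K (weightedHomogeneousSubmodule K (fun _ : σ => (1 : ℤ)) d) := by
  have hfin := Finsupp.finite_of_degree_eq (σ := σ) d.toNat
  have : Finite {e : σ →₀ ℕ | e.degree = d.toNat} := hfin
  have : FiniteDimensional K (restrictSupport K {e : σ →₀ ℕ | e.degree = d.toNat}) :=
    Module.Finite.of_basis (basisRestrictSupport K _)
  refine Submodule.finiteDimensional_of_le
    (S₂ := restrictSupport K {e : σ →₀ ℕ | e.degree = d.toNat}) fun f hf e he => ?_
  have h := hf (mem_support_iff.1 he)
  rw [weight_one_int] at h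
  change e.degree = d.toNat
  omega

/-- Rank-nullity for the exact sequence `0 → A_{d-1} → A_d → (A / L A)_d → 0`, whose first map is
multiplication by `L`. -/
theorem hilbertFunction_purePowerIdeal_sup_add [CharZero K] {m : ℕ} (hm : 1 ≤ m) {d : ℤ}
    (hd : 2 * (d - 1) < Fintype.card σ * ((m : ℤ) - 1)) :
    hilbertFunction (purePowerIdeal σ K m ⊔ Ideal.span {∑ i, X i}) d +
      (freeExponents σ m (d - 1)).ncard = (freeExponents σ m d).ncard := by
  set J := purePowerIdeal σ K m with hJ
  set I := J ⊔ Ideal.span {∑ i, (X i : MvPolynomial σ K)} with hI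
  let R (d : ℤ) := weightedHomogeneousSubmodule K (fun _ : σ => (1 : ℤ)) d
  let π := (Ideal.Quotient.mkₐ K J).toLinearMap
  let θ := (Ideal.Quotient.factorₐ K (le_sup_left : J ≤ I)).toLinearMap
  let μ := LinearMap.mulLeft K (π (∑ i, X i))
  have hL : (∑ i, X i : MvPolynomial σ K).IsWeightedHomogeneous (fun _ : σ => (1 : ℤ)) 1 :=
    IsWeightedHomogeneous.sum _ _ _ fun i _ => isWeightedHomogeneous_X K _ i
  have hmap : (R d).map (Ideal.Quotient.mkₐ K I).toLinearMap = ((R d).map π).map θ := by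
    rw [← Submodule.map_comp]
    rfl
  have hker : (R d).map π ⊓ LinearMap.ker θ = ((R (d - 1)).map π).map μ := by
    apply le_antisymm
    · rintro _ ⟨⟨f, hf, rfl⟩, hθ⟩
      have hfI : f ∈ I := Ideal.Quotient.eq_zero_iff_mem.1 hθ
      obtain ⟨j, hj, g, hg, hfg⟩ := Submodule.mem_sup.1 hfI
      obtain ⟨g, rfl⟩ := Ideal.mem_span_singleton.1 hg
      -- The cofactor of `L` need not be homogeneous; only its degree `d - 1` part contributes in
      -- degree `d`.
      refine ⟨_, ⟨weightedHomogeneousComponent (fun _ : σ => (1 : ℤ)) (d - 1) g,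
        weightedHomogeneousComponent_mem _ _ _, rfl⟩, ?_⟩
      have h1 := congrArg (weightedHomogeneousComponent (fun _ : σ => (1 : ℤ)) d) hfg
      rw [map_add, weightedHomogeneousComponent_sum_X_mul,
        weightedHomogeneousComponent_eq_self hf] at h1
      rw [← h1]
      refine ((Ideal.Quotient.mk_eq_mk_iff_sub_mem _ _).2 ?_).symm
      rw [add_sub_cancel_right]
      exact weightedHomogeneousComponent_mem_purePowerIdeal hj d
    · rintro _ ⟨_, ⟨f, hf, rfl⟩, rfl⟩
      refine ⟨⟨(∑ i, X i) * f, ?_, rfl⟩, ?_⟩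
      · have := hL.mul hf
        rwa [add_sub_cancel] at this
      · exact Ideal.Quotient.eq_zero_iff_mem.2
          (I.mul_mem_right _ (le_sup_right (a := J) (Ideal.mem_span_singleton_self _)))
  have hinj : Function.Injective (μ.domRestrict ((R (d - 1)).map π)) := by
    rw [← LinearMap.ker_eq_bot, LinearMap.ker_eq_bot']
    rintro ⟨_, f, hf, rfl⟩ h
    exact Subtype.ext (Ideal.Quotient.eq_zero_iff_mem.2
      (mem_purePowerIdeal_of_isWeightedHomogeneous hm hd hf (Ideal.Quotient.eq_zero_iff_mem.1 h)))
  have hfin : FiniteDimensional K ((R d).map π) := by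
    have : FiniteDimensional K (R d) := finiteDimensional_weightedHomogeneousSubmodule d
    infer_instance
  have hμ : Module.finrank K (((R (d - 1)).map π).map μ) =
      Module.finrank K ((R (d - 1)).map π) := by
    rw [← LinearMap.finrank_range_of_inj hinj, LinearMap.range_domRestrict]
  have := finrank_map_add_finrank_inf_ker θ ((R d).map π)
  rw [hker, ← hmap, hμ, finrank_map_mk_purePowerIdeal, finrank_map_mk_purePowerIdeal] at this
  exact this

end Dimension

/-! ### Counting `m`-free monomials. -/

section Counting

theorem ncard_freeExponents_natCast {σ : Type*} [Fintype σ] (s d : ℕ) :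
    (freeExponents σ (s + 1) (d : ℤ)).ncard = sBinomial s (Fintype.card σ) d := by
  classical
  have h : (∑ i ∈ Finset.range (s + 1), (Polynomial.X : Polynomial ℕ) ^ i) ^ Fintype.card σ =
      ∑ x ∈ Fintype.piFinset fun _ : σ => Finset.range (s + 1),
        (Polynomial.X : Polynomial ℕ) ^ ∑ i, x i := by
    rw [← Finset.card_univ, ← Finset.prod_const, Finset.prod_univ_sum]
    exact Finset.sum_congr rfl fun x _ => Finset.prod_pow_eq_pow_sum _ _ _
  rw [sBinomial, h, Polynomial.finsetSum_coeff]
  simp only [Polynomial.coeff_X_pow]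
  rw [← Finset.card_filter, ← Set.ncard_coe_finset,
    ← Set.ncard_image_of_injective _ (DFunLike.coe_injective (F := σ →₀ ℕ))]
  congr 1
  ext x
  simp only [Set.mem_image, Finset.coe_filter, Fintype.mem_piFinset, Finset.mem_range]
  constructor
  · rintro ⟨e, ⟨h1, h2⟩, rfl⟩
    refine ⟨h2, ?_⟩
    rw [← Finsupp.degree_eq_sum]
    exact_mod_cast h1.symm
  · rintro ⟨h1, h2⟩
    refine ⟨Finsupp.equivFunOnFinite.symm x, ⟨?_, h1⟩, rfl⟩
    rw [Finsupp.degree_eq_sum]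
    exact_mod_cast h2.symm

/-- Complementation `e_i ↦ s - e_i`; the truncated subtraction is an involution because `e_i ≤ s`.
-/
theorem ncard_freeExponents_symm {σ : Type*} [Fintype σ] (s : ℕ) (d : ℤ) :
    (freeExponents σ (s + 1) (Fintype.card σ * s - d)).ncard =
      (freeExponents σ (s + 1) d).ncard := by
  let c : (σ →₀ ℕ) → (σ →₀ ℕ) := fun e => Finsupp.equivFunOnFinite.symm fun i => s - e i
  have hc (d : ℤ) : ∀ e ∈ freeExponents σ (s + 1) d,
      c e ∈ freeExponents σ (s + 1) (Fintype.card σ * s - d) := by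
    rintro e ⟨rfl, h⟩
    refine ⟨?_, fun i => Nat.lt_succ_of_le (Nat.sub_le _ _)⟩
    rw [Finsupp.degree_eq_sum, Finsupp.degree_eq_sum, eq_sub_iff_add_eq]
    norm_cast
    rw [← Finset.sum_add_distrib, Finset.sum_congr rfl fun i _ => show c e i + e i = s from
      Nat.sub_add_cancel (Nat.le_of_lt_succ (h i))]
    simp
  have hinv (d : ℤ) : ∀ e ∈ freeExponents σ (s + 1) d, c (c e) = e := fun e he => by
    ext i
    exact Nat.sub_sub_self (Nat.le_of_lt_succ (he.2 i))
  refine Set.ncard_congr (fun e _ => c e) (fun e he => ?_) (fun e f he hf hef => ?_)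
    fun e he => ⟨c e, hc d e he, hinv d e he⟩
  · have := hc _ e he
    rwa [sub_sub_cancel] at this
  · rw [← hinv _ e he, ← hinv _ f hf]
    exact congrArg c hef

end Counting

/-! ### Paths and exponent vectors. -/

section Paths

variable {N : ℕ}

/-- Up and flat steps carry exponents `0` and `1`, which are `m`-free because `2 ≤ m`. -/
theorem isAdmissiblePath_iff {m : ℕ} (hm : 2 ≤ m) (P : Fin (N + 1) → ℤ × ℤ) :
    IsAdmissiblePath (fun _ => m) P ↔ P 0 = (0, 0) ∧ (∀ i, pathMonomial P i < m) ∧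
      ∀ i : Fin N, P i.succ = P i.castSucc + (1, 1 - (pathMonomial P i : ℤ)) := by
  have key (i : Fin N) : (P i.succ = P i.castSucc + (1, 1) ∨
      P i.succ = P i.castSucc + (1, 0) ∨
      ∃ e : ℕ, 2 ≤ e ∧ e + 1 ≤ m ∧ P i.succ = P i.castSucc + (1, 1 - (e : ℤ))) ↔
      pathMonomial P i < m ∧ P i.succ = P i.castSucc + (1, 1 - (pathMonomial P i : ℤ)) := by
    have hp : pathMonomial P i = (1 - ((P i.succ).2 - (P i.castSucc).2)).toNat := rfl
    simp only [Prod.ext_iff, Prod.fst_add, Prod.snd_add]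
    constructor
    · rintro (⟨h1, h2⟩ | ⟨h1, h2⟩ | ⟨e, he, hem, h1, h2⟩) <;> omega
    · rintro ⟨h, h1, h2⟩
      by_cases h3 : 2 ≤ pathMonomial P i
      · exact Or.inr (Or.inr ⟨_, h3, h, h1, h2⟩)
      · omega
  rw [IsAdmissiblePath, forall_congr' key, forall_and]

/-- The lattice path whose `i`-th step is `(1, 1 - e i)`. -/
def exponentPath (e : Fin N →₀ ℕ) : Fin (N + 1) → ℤ × ℤ :=
  Fin.partialSum fun i => ((1, 1 - (e i : ℤ)) : ℤ × ℤ)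

theorem exponentPath_succ (e : Fin N →₀ ℕ) (i : Fin N) :
    exponentPath e i.succ = exponentPath e i.castSucc + (1, 1 - (e i : ℤ)) :=
  Fin.partialSum_succ _ _

theorem pathMonomial_exponentPath (e : Fin N →₀ ℕ) : pathMonomial (exponentPath e) = e := by
  ext i
  change (1 - ((exponentPath e i.succ).2 - (exponentPath e i.castSucc).2)).toNat = e i
  rw [exponentPath_succ, Prod.snd_add]
  omega

theorem bijOn_pathMonomial {m : ℕ} (hm : 2 ≤ m) (T : Set (Fin N →₀ ℕ))
    (hT : ∀ e ∈ T, ∀ i, e i < m) :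
    Set.BijOn pathMonomial {P | IsAdmissiblePath (fun _ => m) P ∧ pathMonomial P ∈ T} T := by
  refine ⟨fun P hP => hP.2, fun P hP Q hQ hPQ => ?_, fun e he => ?_⟩
  · obtain ⟨hP0, -, hP1⟩ := (isAdmissiblePath_iff hm P).1 hP.1
    obtain ⟨hQ0, -, hQ1⟩ := (isAdmissiblePath_iff hm Q).1 hQ.1
    funext j
    induction j using Fin.induction with
    | zero => rw [hP0, hQ0]
    | succ i ih => rw [hP1, hQ1, ih, hPQ]
  · refine ⟨exponentPath e, ⟨(isAdmissiblePath_iff hm _).2 ⟨Fin.partialSum_zero _, ?_, ?_⟩, ?_⟩,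
      pathMonomial_exponentPath e⟩
    · rw [pathMonomial_exponentPath]
      exact hT e he
    · rw [pathMonomial_exponentPath]
      exact exponentPath_succ e
    · rwa [pathMonomial_exponentPath]

end Paths

/-! ### Specialization to the ideal of the theorem. -/

section PowerIdeal

variable {K : Type*} [Field K]

theorem powerIdeal_one_eq_sup (N m : ℕ) :
    powerIdeal K N (fun _ => m) 1 = purePowerIdeal (Fin N) K m ⊔ Ideal.span {∑ i, X i} := by
  rw [powerIdeal, purePowerIdeal, Ideal.span_union, pow_one]

theorem weightedHomogeneousComponent_mem_powerIdeal {N m : ℕ} {f : MvPolynomial (Fin N) K}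
    (hf : f ∈ powerIdeal K N (fun _ => m) 1) (d : ℤ) :
    weightedHomogeneousComponent (fun _ : Fin N => (1 : ℤ)) d f ∈
      powerIdeal K N (fun _ => m) 1 := by
  rw [powerIdeal_one_eq_sup] at hf ⊢
  obtain ⟨j, hj, g, hg, rfl⟩ := Submodule.mem_sup.1 hf
  obtain ⟨g, rfl⟩ := Ideal.mem_span_singleton.1 hg
  rw [map_add, weightedHomogeneousComponent_sum_X_mul]
  exact Submodule.add_mem_sup (weightedHomogeneousComponent_mem_purePowerIdeal hj d)
    (Ideal.mul_mem_right _ _ (Ideal.mem_span_singleton_self _))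

theorem lt_of_monomial_notMem_initialIdeal {N m : ℕ} (ord : MonomialOrder (Fin N))
    {e : Fin N →₀ ℕ}
    (he : monomial e (1 : K) ∉ initialIdeal ord (powerIdeal K N (fun _ => m) 1)) (i : Fin N) :
    e i < m := by
  by_contra! h
  classical
  refine he ((monomial_mem_initialIdeal_iff ord _ e).2 ⟨monomial (Finsupp.single i m) 1, ?_, ?_, ?_⟩)
  · rw [← X_pow_eq_monomial]
    exact Ideal.subset_span (Or.inl ⟨i, rfl⟩)
  · simp
  · rwa [ord.degree_monomial, if_neg one_ne_zero, Finsupp.single_le_iff]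

theorem sCatalanTriangle_eq_hilbertFunction [CharZero K] {m : ℕ} (hm : 1 ≤ m) (n k : ℕ) :
    sCatalanTriangle (m - 1) n k =
      (hilbertFunction (powerIdeal K (2 * n) (fun _ => m) 1)
        ((n : ℤ) * ((m : ℤ) - 1) - (k : ℤ)) : ℤ) := by
  obtain ⟨s, rfl⟩ := Nat.exists_eq_add_of_le' hm
  have hcast : ((s + 1 : ℕ) : ℤ) - 1 = s := by push_cast; ring
  have h := hilbertFunction_purePowerIdeal_sup_add (σ := Fin (2 * n)) (K := K) (m := s + 1)
    (by omega) (d := (n : ℤ) * s - k) (by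
      rw [hcast, Fintype.card_fin]
      push_cast
      linarith [(Nat.cast_nonneg k : (0 : ℤ) ≤ k)])
  -- Reflection about the middle degree `n s`; `j = k` and `j = k + 1` give degrees `d` and `d - 1`.
  have hb (j : ℕ) : sBinomial s (2 * n) (s * n + j) =
      (freeExponents (Fin (2 * n)) (s + 1) ((n : ℤ) * s - j)).ncard := by
    have h1 := ncard_freeExponents_natCast (σ := Fin (2 * n)) s (s * n + j)
    rw [Fintype.card_fin] at h1
    rw [← h1, ← ncard_freeExponents_symm, Fintype.card_fin]
    congr 2
    push_cast
    ring
  rw [sCatalanTriangle, Nat.add_sub_cancel, hb k, add_assoc, hb (k + 1), hcast,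
    powerIdeal_one_eq_sup, ← h]
  push_cast
  rw [sub_sub, add_sub_cancel_right]

end PowerIdeal

end CatalanPaths

theorem mainTheorem9 {K : Type*} [Field K] [CharZero K] (m n k : ℕ) (hm : 2 ≤ m) (hn : 1 ≤ n)
    (ord : MonomialOrder (Fin (2 * n)))
    (hord : ∀ i j : Fin (2 * n), i < j →
      ord.toSyn (Finsupp.single j 1) < ord.toSyn (Finsupp.single i 1)) :
    {P : Fin (2 * n + 1) → ℤ × ℤ |
        CatalanPaths.IsAdmissiblePath (fun _ => m) P ∧
        ((CatalanPaths.pathMonomial P).degree : ℤ) = (n : ℤ) * ((m : ℤ) - 1) - (k : ℤ) ∧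
        MvPolynomial.monomial (CatalanPaths.pathMonomial P) (1 : K) ∉
          CatalanPaths.initialIdeal ord
            (CatalanPaths.powerIdeal K (2 * n) (fun _ => m) 1)}.Finite ∧
    CatalanPaths.sCatalanTriangle (m - 1) n k =
      ({P : Fin (2 * n + 1) → ℤ × ℤ |
        CatalanPaths.IsAdmissiblePath (fun _ => m) P ∧
        ((CatalanPaths.pathMonomial P).degree : ℤ) = (n : ℤ) * ((m : ℤ) - 1) - (k : ℤ) ∧
        MvPolynomial.monomial (CatalanPaths.pathMonomial P) (1 : K) ∉
          CatalanPaths.initialIdeal ord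
            (CatalanPaths.powerIdeal K (2 * n) (fun _ => m) 1)}.ncard : ℤ) ∧
    CatalanPaths.sCatalanTriangle (m - 1) n k =
      (CatalanPaths.hilbertFunction (CatalanPaths.powerIdeal K (2 * n) (fun _ => m) 1)
        ((n : ℤ) * ((m : ℤ) - 1) - (k : ℤ)) : ℤ) := by
  set d : ℤ := (n : ℤ) * ((m : ℤ) - 1) - (k : ℤ) with hd
  have hbij := CatalanPaths.bijOn_pathMonomial hm
    {e : Fin (2 * n) →₀ ℕ | (e.degree : ℤ) = d ∧ MvPolynomial.monomial e (1 : K) ∉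
      CatalanPaths.initialIdeal ord (CatalanPaths.powerIdeal K (2 * n) (fun _ => m) 1)}
    fun e he => CatalanPaths.lt_of_monomial_notMem_initialIdeal ord he.2
  have hH := CatalanPaths.sCatalanTriangle_eq_hilbertFunction (K := K) (m := m) (by omega) n k
  refine ⟨?_, ?_, hH⟩
  · refine hbij.finite_iff_finite.2
      ((Finsupp.finite_of_degree_eq (σ := Fin (2 * n)) d.toNat).subset fun e he => ?_)
    have := he.1
    change e.degree = d.toNat
    omega
  · rw [hH, CatalanPaths.hilbertFunction_eq_ncard_standard ord _ _ fun f hf =>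
      CatalanPaths.weightedHomogeneousComponent_mem_powerIdeal hf _, ← hbij.image_eq,
      hbij.injOn.ncard_image]
    rfl
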